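/- Let $d\ge 1$ and let $A_n\in\mathbb R^{d,d}$, $n\in\mathbb N_0$, be invertible matrices such that $\sup_n\|A_n\|<\infty$ and $\sup_n\|A_n^{-1}\|<\infty$. Let $\Phi(n,m)=A_{n-1}\cdots A_m$ for $n>m$, $\Phi(n,n)=I$ and $\Phi(n,m)=A_n^{-1}\cdots A_{m-1}^{-1}$ for $n<m$ be the solution operator of $u_{n+1}=A_nu_n$. *Angular values.* Let $\mathcal G(s,d)$ be the set of $s$-dimensional subspaces of $\mathbb R^d$. For $V,W\in\mathcal G(s,d)$ let $\angle(V,W)\in[0,\frac\pi2]$ be the largest principal angle, i.e. the arccosine of the smallest singular value of $V_B^\top W_B$, where the columns of $V_B,W_B$ are orthonormal bases of $V,W$. For $1\le s\le d$ and $V\in\mathcal G(s,d)$ put $$a_{1,n}(V)=\sum_{j=1}^n\angle(\Phi(j-1,0)V,\Phi(j,0)V),$$ $$\hat\theta_s=\sup_{V\in\mathcal G(s,d)}\limsup_{n\to\infty}\tfrac1n a_{1,n}(V),\qquad \underline{\hat\theta}_s=\sup_{V\in\mathcal G(s,d)}\liminf_{n\to\infty}\tfrac1n a_{1,n}(V)$$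 (the upper and lower $s$-th outer angular values). *Dichotomy spectrum.* A system $u_{n+1}=B_nu_n$ with solution operator $\Psi$ has an exponential dichotomy on $\mathbb N_0$ with projectors $P_n^s$, $P_n^u=I-P_n^s$ if $P_n^{s,u}\Psi(n,m)=\Psi(n,m)P_m^{s,u}$ for all $n,m$ and there are $K>0$, $\alpha_s,\alpha_u\in(0,1)$ with $\|\Psi(n,m)P_m^s\|\le K\alpha_s^{n-m}$ and $\|\Psi(m,n)P_n^u\|\le K\alpha_u^{n-m}$ for all $n\ge m$. Suppose that the set of all $\gamma>0$ for which $u_{n+1}=\frac1\gamma A_nu_n$ has no exponential dichotomy on $\mathbb N_0$ is $\bigcup_{i=1}^\ell[\sigma_i^-,\sigma_i^+]$ with $0<\sigma_\ell^-\le\sigma_\ell^+<\dots<\sigma_1^-\le\sigma_1^+$. Put $R_1=(\sigma_1^+,\infty)$, $R_i=(\sigma_i^+,\sigma_{i-1}^-)$ for $2\le i\le \ell$ and $R_{\ell+1}=(0,\sigma_\ell^-)$. For $i=1,\dots,\ell+1$ let $(P_{n,i}^s)_{n\in\mathbb N_0}$, $P_{n,i}^u=I-P_{n,i}^s$, be dichotomy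 projectors of $u_{n+1}=\frac1\gamma A_nu_n$ for all $\gamma\in R_i$. For $i=1,\dots,\ell$ let $$\mathcal W_n^i=\operatorname{range}(P_{n,i}^s)\cap\operatorname{range}(P_{n,i+1}^u)$$ be the spectral fibers. *Trace spaces.* Let $\mathcal D_0(s,d)$ be the set of all direct sums $\bigoplus_{i=1}^\ell W_i$ of subspaces $W_i\subseteq\mathcal W_0^i$ with $\sum_{i=1}^\ell\dim W_i=s$, and for $V\in\mathcal G(s,d)$ let $$\mathcal T_0(V)=\bigoplus_{i=1}^\ell P_{0,i+1}^u\big(\operatorname{range}(P_{0,i}^s)\cap V\big).$$ Then the following holds. 1. For all $1\le s\le d$ and $V\in\mathcal G(s,d)$ one has $\mathcal T_0(V)\in\mathcal D_0(s,d)$ and $$\limsup_{n\to\infty}\tfrac1n a_{1,n}(V)=\limsup_{n\to\infty}\tfrac1n a_{1,n}(\mathcal T_0(V)),\qquad \liminf_{n\to\infty}\tfrac1n a_{1,n}(V)=\liminf_{n\to\infty}\tfrac1n a_{1,n}(\mathcal T_0(V)).$$ 2. For all $1\le s\le d$, $$\hat\theta_s=\sup_{V\in\mathcal D_0(s,d)}\limsup_{n\to\infty}\tfrac1n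 a_{1,n}(V),\qquad \underline{\hat\theta}_s=\sup_{V\in\mathcal D_0(s,d)}\liminf_{n\to\infty}\tfrac1n a_{1,n}(V).$$ 3. If $\dim\mathcal W_m^i=1$ for all $i=1,\dots,\ell$ and $m\in\mathbb N_0$ (so that $\ell=d$), then $$\underline{\hat\theta}_1=\max_{i=1,\dots,\ell}\liminf_{n\to\infty}\tfrac1n\sum_{j=1}^n\angle(\mathcal W_{j-1}^i,\mathcal W_j^i),\qquad \hat\theta_1=\max_{i=1,\dots,\ell}\limsup_{n\to\infty}\tfrac1n\sum_{j=1}^n\angle(\mathcal W_{j-1}^i,\mathcal W_j^i).$$ -/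

import Mathlib

open Filter Topology

noncomputable section

namespace AngularValues

/-! The definitions are stated on a finite-dimensional real inner product space `E`, which is
`ℝ^d` with the Euclidean inner product in the application. Linear operators `E →L[ℝ] E` (for
`E = ℝ^d`: real `d × d` matrices) carry the operator norm. -/

variable {E : Type*} [NormedAddCommGroup E] [InnerProductSpace ℝ E]

/-- The system `u_{n+1} = A_n u_n` is bounded invertible: every `A_n` is invertible, and `A_n` and
`A_n⁻¹` are bounded uniformly in `n`. -/
def BoundedInvertible (A : ℕ → E →L[ℝ] E) : Prop :=
  (∀ n, IsUnit (A n)) ∧ ∃ C : ℝ, ∀ n, ‖A n‖ ≤ C ∧ ‖Ring.inverse (A n)‖ ≤ C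

/-- The product `A_{m+k-1} ⋯ A_m`. -/
def fwdProd (A : ℕ → E →L[ℝ] E) (m : ℕ) : ℕ → E →L[ℝ] E
  | 0 => 1
  | k + 1 => A (m + k) * fwdProd A m k

/-- The product `A_n⁻¹ ⋯ A_{n+k-1}⁻¹`. -/
def bwdProd (A : ℕ → E →L[ℝ] E) (n : ℕ) : ℕ → E →L[ℝ] E
  | 0 => 1
  | k + 1 => bwdProd A n k * Ring.inverse (A (n + k))

/-- The solution operator `Φ(n, m)`: it is `A_{n-1} ⋯ A_m` for `n > m`, the identity for `n = m`,
and `A_n⁻¹ ⋯ A_{m-1}⁻¹` for `n < m`. -/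
def solOp (A : ℕ → E →L[ℝ] E) (n m : ℕ) : E →L[ℝ] E :=
  if m ≤ n then fwdProd A m (n - m) else bwdProd A n (m - n)

/-! ### Angular values -/

/-- The largest principal angle between two subspaces `V`, `W` of the same dimension `k ≥ 1`: the
arccosine of the smallest singular value of `V_Bᵀ W_B`, where the columns of `V_B` and `W_B` are
orthonormal bases of `V` and `W`. The matrix `V_Bᵀ W_B` represents, in these bases, the map
`W → V` that restricts the orthogonal projection onto `V`; its singular values in decreasing order
have the indices `0, …, k - 1`. -/
def ang [FiniteDimensional ℝ E] (V W : Submodule ℝ E) : ℝ :=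
  Real.arccos
    ((V.orthogonalProjectionOnto.toLinearMap ∘ₗ W.subtype).singularValues
      (Module.finrank ℝ W - 1))

/-- `a_{m,n}(V) = ∑_{j=m}^n ∠(Φ(j-1,0)V, Φ(j,0)V)` (for `m ≥ 1`). -/
def angSum [FiniteDimensional ℝ E] (A : ℕ → E →L[ℝ] E) (m n : ℕ) (V : Submodule ℝ E) : ℝ :=
  ∑ j ∈ Finset.Icc m n,
    ang (V.map (solOp A (j - 1) 0).toLinearMap) (V.map (solOp A j 0).toLinearMap)

/-- `limsup_{n → ∞} (1/n) a_{1,n}(V)`. The averages lie in `[0, π/2]`. -/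
def limsupAvg [FiniteDimensional ℝ E] (A : ℕ → E →L[ℝ] E) (V : Submodule ℝ E) : ℝ :=
  limsup (fun n : ℕ => 1 / (n : ℝ) * angSum A 1 n V) atTop

/-- `liminf_{n → ∞} (1/n) a_{1,n}(V)`. -/
def liminfAvg [FiniteDimensional ℝ E] (A : ℕ → E →L[ℝ] E) (V : Submodule ℝ E) : ℝ :=
  liminf (fun n : ℕ => 1 / (n : ℝ) * angSum A 1 n V) atTop

/-- The Grassmannian of `s`-dimensional subspaces of `E`. -/
def grassmannian (E : Type*) [NormedAddCommGroup E] [InnerProductSpace ℝ E] (s : ℕ) :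
    Set (Submodule ℝ E) := {V | Module.finrank ℝ V = s}

/-- The upper `s`-th outer angular value. -/
def upperOuter [FiniteDimensional ℝ E] (A : ℕ → E →L[ℝ] E) (s : ℕ) : ℝ :=
  sSup (limsupAvg A '' grassmannian E s)

/-- The lower `s`-th outer angular value. -/
def lowerOuter [FiniteDimensional ℝ E] (A : ℕ → E →L[ℝ] E) (s : ℕ) : ℝ :=
  sSup (liminfAvg A '' grassmannian E s)

/-! ### Exponential dichotomies and the dichotomy spectrum on `ℕ` -/

/-- The system given by `A` has an exponential dichotomy on `ℕ` with dichotomy data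
`(K, αs, αu, P, 1 - P)`; here `P n` is the stable projector at time `n` and `1 - P n` the unstable
one. -/
structure DichotomyData (A : ℕ → E →L[ℝ] E) (K αs αu : ℝ) (P : ℕ → E →L[ℝ] E) : Prop where
  K_pos : 0 < K
  αs_mem : αs ∈ Set.Ioo (0 : ℝ) 1
  αu_mem : αu ∈ Set.Ioo (0 : ℝ) 1
  projector : ∀ n, P n * P n = P n
  invariant_s : ∀ n m, P n * solOp A n m = solOp A n m * P m
  invariant_u : ∀ n m, (1 - P n) * solOp A n m = solOp A n m * (1 - P m)
  estimate_s : ∀ n m, m ≤ n → ‖solOp A n m * P m‖ ≤ K * αs ^ (n - m)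
  estimate_u : ∀ n m, m ≤ n → ‖solOp A m n * (1 - P n)‖ ≤ K * αu ^ (n - m)

/-- `P` is a family of (stable) dichotomy projectors of the system given by `A`. -/
def IsDichotomyProj (A : ℕ → E →L[ℝ] E) (P : ℕ → E →L[ℝ] E) : Prop :=
  ∃ K αs αu : ℝ, DichotomyData A K αs αu P

/-- The system given by `A` has an exponential dichotomy on `ℕ`. -/
def HasED (A : ℕ → E →L[ℝ] E) : Prop := ∃ P : ℕ → E →L[ℝ] E, IsDichotomyProj A P

/-- The scaled system `u_{n+1} = (1/γ) A_n u_n`. -/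
def scaled (γ : ℝ) (A : ℕ → E →L[ℝ] E) : ℕ → E →L[ℝ] E := fun n => (1 / γ) • A n

/-- The dichotomy (Sacker-Sell) spectrum. -/
def dichotomySpectrum (A : ℕ → E →L[ℝ] E) : Set ℝ := {γ | 0 < γ ∧ ¬ HasED (scaled γ A)}

/-- The resolvent intervals cut out by spectral intervals `[σm i, σp i]`, `i : Fin l`, that are
numbered from the top down. With indices starting at `0`, the interval number `i : Fin (l + 1)` is
`(σp i, σm (i - 1))`, where the upper end is `∞` for `i = 0` and the lower end is `0` for `i = l`:
the spectral intervals with index `≥ i` lie below it, those with index `< i` above it. -/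
def resolventInterval {l : ℕ} (σm σp : Fin l → ℝ) (i : Fin (l + 1)) : Set ℝ :=
  {γ | 0 < γ ∧ (∀ j : Fin l, i ≤ j.castSucc → σp j < γ) ∧
    (∀ j : Fin l, j.castSucc < i → γ < σm j)}

/-- The system given by `A` has the dichotomy spectrum `⋃ i, [σm i, σp i]` (disjoint compact
intervals in `(0, ∞)`, numbered from the top down), and for each of the resolvent intervals
`P i`, `i : Fin (l + 1)`, is a family of dichotomy projectors of the scaled systems.

On the half line `ℕ` an exponential dichotomy determines only the ranges of the stable projectors;
the complementary ranges of the unstable projectors at one time are free, and any choice is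
allowed here, whether or not it makes the unstable ranges increasing in `i`. -/
structure IsSpectralData {l : ℕ} (A : ℕ → E →L[ℝ] E) (σm σp : Fin l → ℝ)
    (P : Fin (l + 1) → ℕ → E →L[ℝ] E) : Prop where
  pos : ∀ i, 0 < σm i
  le : ∀ i, σm i ≤ σp i
  lt : ∀ i j, i < j → σp j < σm i
  spectrum_eq : dichotomySpectrum A = ⋃ i, Set.Icc (σm i) (σp i)
  projectors : ∀ i, ∀ γ ∈ resolventInterval σm σp i, IsDichotomyProj (scaled γ A) (P i)

/-- The fiber `W_n^i = range P_{n,i}^s ∩ range P_{n,i+1}^u` of the `i`-th spectral bundle at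
time `n`. -/
def fiber {l : ℕ} (P : Fin (l + 1) → ℕ → E →L[ℝ] E) (n : ℕ) (i : Fin l) : Submodule ℝ E :=
  LinearMap.range (P i.castSucc n).toLinearMap ⊓ LinearMap.range (1 - P i.succ n).toLinearMap

/-- The set `D_k(s, dim E)` of trace spaces at time `k`: all direct sums `⨁ i, U i` of subspaces
`U i ⊆ W_k^i` with `∑ i, dim (U i) = s`. -/
def traceSpaces {l : ℕ} (P : Fin (l + 1) → ℕ → E →L[ℝ] E) (k s : ℕ) : Set (Submodule ℝ E) :=
  {V | ∃ U : Fin l → Submodule ℝ E, (∀ i, U i ≤ fiber P k i) ∧ iSupIndep U ∧ V = ⨆ i, U i ∧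
    ∑ i, Module.finrank ℝ (U i) = s}

/-- The trace space `T_k(V) = ⨁ i, P_{k,i+1}^u (range P_{k,i}^s ∩ V)` of `V` at time `k`. -/
def traceSpace {l : ℕ} (P : Fin (l + 1) → ℕ → E →L[ℝ] E) (k : ℕ) (V : Submodule ℝ E) :
    Submodule ℝ E :=
  ⨆ i : Fin l, (LinearMap.range (P i.castSucc k).toLinearMap ⊓ V).map
    (1 - P i.succ k).toLinearMap

end AngularValues

end

/-! On the half line only the stable ranges of the dichotomy projectors are determined. They
decrease from the whole space to zero as the growth rate decreases, and this filtration is all that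
the argument uses (`SpectralFiltration`); the unstable ranges need not be nested.

A vector `x` of `V` in the `i`-th stable range splits into its trace `P_{0,i+1}^u x` in the fiber
`W_0^i` and a remainder `P_{0,i+1}^s x`. If the trace is nonzero, the orbit of the remainder becomes
exponentially small relative to that of the trace. Lifting traces back to `V` in every fiber and
adding up, with fiber projections bounded uniformly in time, exhibits `V` as the image of `T =
T_0(V)` under a linear map `G` with `‖Φ(n,0)(G w - w)‖ ≤ ε_n ‖Φ(n,0) w‖` and `ε_n → 0`
(`exists_lift`). Rank-nullity, telescoped along the filtration, gives `dim T = dim V`.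

Hence the angles between `Φ(n,0)V` and `Φ(n,0)T` tend to zero in both orders. By the triangle
inequality the summands of the two angle sums differ by a null sequence, and Cesàro means remove the
difference. Since trace spaces of dimension `s` are themselves in the Grassmannian, both sets give
the same values. For `s = 1` and one-dimensional fibers, the trace spaces are the fibers, so the
suprema are maxima over a finite set. -/

open Filter Topology

noncomputable section

namespace AngularValues

variable {E : Type*} [NormedAddCommGroup E] [InnerProductSpace ℝ E]

/-! ### Max-min description and triangle inequality for the largest principal angle. -/

section PrincipalAngle

open Module

/-- Rayleigh bound: expand `x` in an eigenbasis of `T* T`, whose smallest eigenvalue is the square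
of the last singular value. -/
lemma singularValues_pred_mul_norm_le {V W : Type*} [NormedAddCommGroup V] [InnerProductSpace ℝ V]
    [FiniteDimensional ℝ V] [NormedAddCommGroup W] [InnerProductSpace ℝ W] [FiniteDimensional ℝ W]
    (T : V →ₗ[ℝ] W) (x : V) : T.singularValues (finrank ℝ V - 1) * ‖x‖ ≤ ‖T x‖ := by
  rcases Nat.eq_zero_or_pos (finrank ℝ V) with h0 | hpos
  · have := finrank_zero_iff.mp h0
    simp [Subsingleton.elim x 0]
  set hT := T.isSymmetric_adjoint_comp_self
  set b := hT.eigenvectorBasis rfl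
  set k : Fin (finrank ℝ V) := ⟨finrank ℝ V - 1, by omega⟩
  have hsq : T.singularValues (finrank ℝ V - 1) ^ 2 = hT.eigenvalues rfl k :=
    T.sq_singularValues_fin rfl k
  have hTx : ‖T x‖ ^ 2 = ∑ i, hT.eigenvalues rfl i * (inner ℝ (b i) x) ^ 2 := by
    have h1 : ‖T x‖ ^ 2 = inner ℝ ((T.adjoint ∘ₗ T) x) x := by
      rw [LinearMap.comp_apply, LinearMap.adjoint_inner_left, real_inner_self_eq_norm_sq]
    rw [h1, ← b.sum_inner_mul_inner]
    refine Finset.sum_congr rfl fun i _ => ?_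
    have h2 : inner ℝ ((T.adjoint ∘ₗ T) x) (b i) = hT.eigenvalues rfl i * inner ℝ (b i) x := by
      rw [hT x (b i), hT.apply_eigenvectorBasis, real_inner_comm]
      exact real_inner_smul_left _ _ _
    rw [h2, sq, mul_assoc]
  have hx : ‖x‖ ^ 2 = ∑ i, (inner ℝ (b i) x) ^ 2 := by
    rw [← real_inner_self_eq_norm_sq, ← b.sum_inner_mul_inner]
    refine Finset.sum_congr rfl fun i _ => ?_
    rw [real_inner_comm x, sq]
  refine le_of_sq_le_sq ?_ (norm_nonneg _)
  rw [mul_pow, hsq, hTx, hx, Finset.mul_sum]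
  refine Finset.sum_le_sum fun i _ => mul_le_mul_of_nonneg_right ?_ (sq_nonneg _)
  exact hT.eigenvalues_antitone rfl (Fin.mk_le_mk.2 (by omega))

lemma exists_norm_eq_singularValues_pred {V W : Type*} [NormedAddCommGroup V]
    [InnerProductSpace ℝ V] [FiniteDimensional ℝ V] [NormedAddCommGroup W] [InnerProductSpace ℝ W]
    [FiniteDimensional ℝ W] (T : V →ₗ[ℝ] W) (hV : 0 < finrank ℝ V) :
    ∃ x : V, x ≠ 0 ∧ ‖T x‖ = T.singularValues (finrank ℝ V - 1) * ‖x‖ := by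
  obtain ⟨x, hx⟩ := (T.hasEigenvalue_adjoint_comp_self_sq_singularValues
    (n := finrank ℝ V - 1) (by omega)).exists_hasEigenvector
  refine ⟨x, hx.2, ?_⟩
  have h1 : ‖T x‖ ^ 2 = inner ℝ ((T.adjoint ∘ₗ T) x) x := by
    rw [LinearMap.comp_apply, LinearMap.adjoint_inner_left, real_inner_self_eq_norm_sq]
  rw [hx.apply_eq_smul, real_inner_smul_left, real_inner_self_eq_norm_sq, ← mul_pow] at h1
  exact (sq_eq_sq₀ (norm_nonneg _) (mul_nonneg (T.singularValues_nonneg _) (norm_nonneg _))).1 h1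

variable [FiniteDimensional ℝ E]

/-- The orthogonal projection of `w` is the witness. With `ang_le_of_forall_exists` this describes
`ang V W` as the maximum over `w` of the minimum over `v` of the vector angle, which reduces the
triangle inequality to the one for vectors. -/
lemma exists_angle_le_ang (V : Submodule ℝ E) {W : Submodule ℝ E} {w : E} (hw : w ∈ W)
    (hw0 : w ≠ 0) : ∃ v ∈ V, InnerProductGeometry.angle w v ≤ ang V W := by
  refine ⟨V.starProjection w, V.starProjection_apply_mem w, ?_⟩
  have h := singularValues_pred_mul_norm_le
    (V.orthogonalProjectionOnto.toLinearMap ∘ₗ W.subtype) ⟨w, hw⟩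
  have h' : ‖(V.orthogonalProjectionOnto.toLinearMap ∘ₗ W.subtype) ⟨w, hw⟩‖
      = ‖V.starProjection w‖ := rfl
  rw [h', Submodule.coe_norm] at h
  have hin : inner ℝ w (V.starProjection w) = ‖V.starProjection w‖ ^ 2 := by
    rw [← real_inner_self_eq_norm_sq, ← sub_eq_zero, ← inner_sub_left]
    exact V.starProjection_inner_eq_zero w _ (V.starProjection_apply_mem w)
  refine Real.arccos_le_arccos ?_
  rw [hin]
  have hw' : 0 < ‖w‖ := norm_pos_iff.2 hw0
  -- If the projection vanishes, the vector angle is `π/2` by convention, and the smallest singular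
  -- value is zero as well.
  rcases (norm_nonneg (V.starProjection w)).eq_or_lt with h0 | h0
  · rw [← h0] at h ⊢
    simpa using nonpos_of_mul_nonpos_left h hw'
  · rw [le_div_iff₀ (by positivity)]
    nlinarith

lemma ang_nonneg (V W : Submodule ℝ E) : 0 ≤ ang V W := Real.arccos_nonneg _

lemma ang_le_pi_div_two (V W : Submodule ℝ E) : ang V W ≤ Real.pi / 2 :=
  Real.arccos_le_pi_div_two.2 (LinearMap.singularValues_nonneg _ _)

lemma ang_le_of_forall_exists {V W : Submodule ℝ E} (hW : W ≠ ⊥) {t : ℝ}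
    (h : ∀ w ∈ W, w ≠ 0 → ∃ v ∈ V, InnerProductGeometry.angle w v ≤ t) : ang V W ≤ t := by
  have hpos : 0 < finrank ℝ W := Nat.pos_of_ne_zero fun h0 => hW (Submodule.finrank_eq_zero.1 h0)
  obtain ⟨⟨w, hw⟩, hw0, hmin⟩ := exists_norm_eq_singularValues_pred
    (V.orthogonalProjectionOnto.toLinearMap ∘ₗ W.subtype) hpos
  have h' : ‖(V.orthogonalProjectionOnto.toLinearMap ∘ₗ W.subtype) ⟨w, hw⟩‖
      = ‖V.starProjection w‖ := rfl
  rw [h', Submodule.coe_norm] at hmin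
  have hw0' : w ≠ 0 := fun h0 => hw0 (Subtype.ext h0)
  obtain ⟨v, hv, hvt⟩ := h w hw hw0'
  refine le_trans (Real.arccos_le_arccos ?_) hvt
  rcases eq_or_ne v 0 with rfl | hv0
  · simpa using LinearMap.singularValues_nonneg _ _
  · have hin : inner ℝ w v = inner ℝ (V.starProjection w) v := by
      rw [Submodule.inner_starProjection_left_eq_right, Submodule.starProjection_eq_self_iff.2 hv]
    have : 0 < ‖w‖ := norm_pos_iff.2 hw0'
    have : 0 < ‖v‖ := norm_pos_iff.2 hv0
    rw [div_le_iff₀ (by positivity), hin]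
    refine (real_inner_le_norm _ _).trans ?_
    rw [hmin, mul_assoc]

lemma ang_triangle (U V : Submodule ℝ E) {W : Submodule ℝ E} (hW : W ≠ ⊥) :
    ang U W ≤ ang U V + ang V W := by
  refine ang_le_of_forall_exists hW fun w hw hw0 => ?_
  obtain ⟨v, hv, hvw⟩ := exists_angle_le_ang V hw hw0
  rcases eq_or_ne v 0 with rfl | hv0
  · refine ⟨0, U.zero_mem, hvw.trans ?_⟩
    linarith [ang_nonneg U V]
  · obtain ⟨u, hu, huv⟩ := exists_angle_le_ang U hv hv0
    refine ⟨u, hu, (InnerProductGeometry.angle_le_angle_add_angle w v u).trans ?_⟩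
    linarith

/-- Law of cosines: multiplying the two bounds gives `‖w - v‖² ≤ ε² ‖w‖ ‖v‖`, hence `cos ∠(w, v) ≥ 1
- ε²/2`. The condition `ε < 1` excludes `v = 0`. -/
lemma ang_le_arccos_of_close {V W : Submodule ℝ E} (hW : W ≠ ⊥) {ε : ℝ} (hε : ε < 1)
    (h : ∀ w ∈ W, ∃ v ∈ V, ‖w - v‖ ≤ ε * ‖w‖ ∧ ‖w - v‖ ≤ ε * ‖v‖) :
    ang V W ≤ Real.arccos (1 - ε ^ 2 / 2) := by
  refine ang_le_of_forall_exists hW fun w hw hw0 => ?_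
  obtain ⟨v, hv, h1, h2⟩ := h w hw
  refine ⟨v, hv, Real.arccos_le_arccos ?_⟩
  have hwp : 0 < ‖w‖ := norm_pos_iff.2 hw0
  have hvp : 0 < ‖v‖ := by
    refine norm_pos_iff.2 fun h0 => ?_
    rw [h0, sub_zero] at h1
    nlinarith
  rw [le_div_iff₀ (by positivity)]
  have h3 := norm_sub_sq_real w v
  have h4 : ‖w - v‖ * ‖w - v‖ ≤ (ε * ‖w‖) * (ε * ‖v‖) :=
    mul_le_mul h1 h2 (norm_nonneg _) ((norm_nonneg _).trans h1)
  nlinarith [sq_nonneg (‖w‖ - ‖v‖)]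

end PrincipalAngle

/-! ### Solution operators started at time zero. -/

section SolutionOperator

lemma solOp_self (A : ℕ → E →L[ℝ] E) (n : ℕ) : solOp A n n = 1 := by
  simp [solOp, fwdProd]

lemma solOp_zero_right (A : ℕ → E →L[ℝ] E) (n : ℕ) : solOp A n 0 = fwdProd A 0 n := by
  simp [solOp]

lemma solOp_zero_left (A : ℕ → E →L[ℝ] E) (n : ℕ) : solOp A 0 n = bwdProd A 0 n := by
  cases n <;> simp [solOp, fwdProd, bwdProd]

lemma solOp_succ_zero (A : ℕ → E →L[ℝ] E) (n : ℕ) : solOp A (n + 1) 0 = A n * solOp A n 0 := by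
  simp [solOp_zero_right, fwdProd]

lemma solOp_mul_solOp_zero {A : ℕ → E →L[ℝ] E} (hA : ∀ n, IsUnit (A n)) (n : ℕ) :
    solOp A 0 n * solOp A n 0 = 1 := by
  rw [solOp_zero_left, solOp_zero_right]
  induction n with
  | zero => simp [fwdProd, bwdProd]
  | succ n ih =>
    rw [fwdProd, bwdProd, mul_assoc, ← mul_assoc (Ring.inverse _), Ring.inverse_mul_cancel _ (hA _),
      one_mul, ih]

lemma isUnit_solOp_zero {A : ℕ → E →L[ℝ] E} (hA : ∀ n, IsUnit (A n)) (n : ℕ) :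
    IsUnit (solOp A n 0) := by
  induction n with
  | zero => rw [solOp_self]; exact isUnit_one
  | succ n ih => rw [solOp_succ_zero]; exact (hA n).mul ih

lemma solOp_zero_injective {A : ℕ → E →L[ℝ] E} (hA : ∀ n, IsUnit (A n)) (n : ℕ) :
    Function.Injective (solOp A n 0) := by
  refine Function.LeftInverse.injective (g := solOp A 0 n) fun x => ?_
  rw [← mul_apply_eq_comp, solOp_mul_solOp_zero hA, one_apply_eq_self]

lemma solOp_zero_surjective {A : ℕ → E →L[ℝ] E} (hA : ∀ n, IsUnit (A n)) (n : ℕ) :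
    Function.Surjective (solOp A n 0) := by
  intro y
  obtain ⟨B, hB⟩ := (isUnit_solOp_zero hA n).exists_right_inv
  exact ⟨B y, by rw [← mul_apply_eq_comp, hB, one_apply_eq_self]⟩

lemma solOp_scaled_zero (γ : ℝ) (A : ℕ → E →L[ℝ] E) (n : ℕ) :
    solOp (scaled γ A) n 0 = (1 / γ) ^ n • solOp A n 0 := by
  induction n with
  | zero => simp [solOp_self]
  | succ n ih =>
    rw [solOp_succ_zero, solOp_succ_zero, ih, scaled, smul_mul_smul_comm, pow_succ']

lemma isUnit_scaled {γ : ℝ} (hγ : 0 < γ) {A : ℕ → E →L[ℝ] E} (hA : ∀ n, IsUnit (A n)) (n : ℕ) :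
    IsUnit (scaled γ A n) := by
  have h := (hA n).smul (Units.mk0 (1 / γ) (by positivity))
  exact h

lemma norm_solOp_zero_le {A : ℕ → E →L[ℝ] E} {C : ℝ} (hC : ∀ n, ‖A n‖ ≤ C) (n : ℕ) (x : E) :
    ‖solOp A n 0 x‖ ≤ C ^ n * ‖x‖ := by
  induction n with
  | zero => simp [solOp_self]
  | succ n ih =>
    rw [solOp_succ_zero, mul_apply_eq_comp, pow_succ', mul_assoc]
    exact ((A n).le_opNorm _).trans
      (mul_le_mul (hC n) ih (norm_nonneg _) ((norm_nonneg _).trans (hC n)))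

lemma norm_le_norm_solOp_zero {A : ℕ → E →L[ℝ] E} (hA : ∀ n, IsUnit (A n)) {C : ℝ}
    (hC : ∀ n, ‖Ring.inverse (A n)‖ ≤ C) (n : ℕ) (x : E) :
    ‖x‖ ≤ C ^ n * ‖solOp A n 0 x‖ := by
  have hC0 : 0 ≤ C := (norm_nonneg _).trans (hC 0)
  induction n with
  | zero => simp [solOp_self]
  | succ n ih =>
    refine ih.trans ?_
    rw [solOp_succ_zero, mul_apply_eq_comp, pow_succ, mul_assoc]
    refine mul_le_mul_of_nonneg_left ?_ (by positivity)
    have h : solOp A n 0 x = Ring.inverse (A n) (A n (solOp A n 0 x)) := by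
      rw [← mul_apply_eq_comp, Ring.inverse_mul_cancel _ (hA n),
        one_apply_eq_self]
    conv_lhs => rw [h]
    exact (ContinuousLinearMap.le_opNorm _ _).trans
      (mul_le_mul_of_nonneg_right (hC n) (norm_nonneg _))

end SolutionOperator

/-! ### From dichotomies to a filtration by stable ranges. -/

section Dichotomy

/-- The consequences of an exponential dichotomy of the system scaled by `γ` that concern the
solutions `n ↦ F n x` of the unscaled system started at time `0`. -/
structure GrowthSplitting (F P : ℕ → E →L[ℝ] E) (γ K α β : ℝ) : Prop where
  γ_pos : 0 < γ
  K_pos : 0 < K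
  α_mem : α ∈ Set.Ioo (0 : ℝ) 1
  β_mem : β ∈ Set.Ioo (0 : ℝ) 1
  idem : ∀ n x, P n (P n x) = P n x
  comm : ∀ n x, P n (F n x) = F n (P 0 x)
  bound : ∀ n, ‖P n‖ ≤ K
  decay : ∀ n x, ‖F n (P 0 x)‖ ≤ K * (γ * α) ^ n * ‖x‖
  growth : ∀ n x, P 0 x = 0 → ‖x‖ ≤ K * (β / γ) ^ n * ‖F n x‖

lemma DichotomyData.growthSplitting {A P : ℕ → E →L[ℝ] E} {γ K α β : ℝ}
    (hA : ∀ n, IsUnit (A n)) (hγ : 0 < γ) (h : DichotomyData (scaled γ A) K α β P) :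
    GrowthSplitting (fun n => solOp A n 0) P γ K α β := by
  have hF (n : ℕ) : solOp A n 0 = γ ^ n • solOp (scaled γ A) n 0 := by
    rw [solOp_scaled_zero, smul_smul, ← mul_pow, mul_one_div_cancel hγ.ne', one_pow, one_smul]
  have hcomm (n : ℕ) (x : E) : P n (solOp A n 0 x) = solOp A n 0 (P 0 x) := by
    have := DFunLike.congr_fun (h.invariant_s n 0) x
    simp only [mul_apply_eq_comp] at this
    simp [hF, this]
  refine ⟨hγ, h.K_pos, h.αs_mem, h.αu_mem, fun n x => ?_, hcomm, fun n => ?_, fun n x => ?_,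
    fun n x hx => ?_⟩
  · rw [← mul_apply_eq_comp, h.projector]
  -- The stable estimate on the diagonal `m = n` bounds the projectors themselves.
  · simpa [solOp_self] using h.estimate_s n n le_rfl
  · have h1 := ((solOp (scaled γ A) n 0 * P 0).le_opNorm x).trans
      (mul_le_mul_of_nonneg_right (h.estimate_s n 0 (Nat.zero_le n)) (norm_nonneg x))
    simp only [hF, smul_apply, norm_smul, norm_pow, Real.norm_eq_abs,
      abs_of_pos hγ]
    rw [mul_apply_eq_comp, Nat.sub_zero] at h1
    calc γ ^ n * ‖solOp (scaled γ A) n 0 (P 0 x)‖ ≤ γ ^ n * (K * α ^ n * ‖x‖) := by gcongr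
      _ = _ := by rw [mul_pow]; ring
  · set y := solOp (scaled γ A) n 0 x with hy
    have hPy : P n y = 0 := by
      have := DFunLike.congr_fun (h.invariant_s n 0) x
      simpa [hx] using this
    have hx' : x = (solOp (scaled γ A) 0 n * (1 - P n)) y := by
      rw [mul_apply_eq_comp, sub_apply, hPy, sub_zero,
        one_apply_eq_self, hy, ← mul_apply_eq_comp,
        solOp_mul_solOp_zero (isUnit_scaled hγ hA), one_apply_eq_self]
    have h1 := ((solOp (scaled γ A) 0 n * (1 - P n)).le_opNorm y).trans
      (mul_le_mul_of_nonneg_right (h.estimate_u n 0 (Nat.zero_le n)) (norm_nonneg y))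
    rw [← hx', Nat.sub_zero] at h1
    refine h1.trans_eq ?_
    simp only [hF, smul_apply, norm_smul, norm_pow, Real.norm_eq_abs,
      abs_of_pos hγ, ← hy]
    rw [div_pow]
    field_simp

lemma nonpos_of_forall_le_mul_pow {c B r : ℝ} (hr0 : 0 ≤ r) (hr1 : r < 1)
    (h : ∀ n : ℕ, c ≤ B * r ^ n) : c ≤ 0 :=
  ge_of_tendsto' (by simpa using (tendsto_pow_atTop_nhds_zero_of_lt_one hr0 hr1).const_mul B) h

namespace GrowthSplitting

variable {F P P' : ℕ → E →L[ℝ] E} {γ K α β γ' K' α' β' : ℝ}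

lemma apply_eq_zero_of_sub (h : GrowthSplitting F P γ K α β) (n : ℕ) (x : E) :
    P n (x - P n x) = 0 := by
  rw [map_sub, h.idem, sub_self]

/-- Solutions of slower growth rate are stable for the larger rate. -/
lemma apply_eq_self_of_lt (h : GrowthSplitting F P γ K α β)
    (h' : GrowthSplitting F P' γ' K' α' β') (hlt : γ' < γ) {x : E} (hx : P' 0 x = x) :
    P 0 x = x := by
  have key : ‖x - P 0 x‖ ≤ 0 := by
    have hγ := h.γ_pos
    have hγ' := h'.γ_pos
    have hK := h.K_pos
    have hK' := h'.K_pos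
    obtain ⟨hβ0, hβ1⟩ := h.β_mem
    obtain ⟨hα0, hα1⟩ := h'.α_mem
    -- The part of `x` that is unstable for `γ` must grow at least like `(γ / β) ^ n`, while the
    -- orbit of `x` is at most of order `(γ' * α') ^ n`.
    have hr : β / γ * (γ' * α') < 1 := by
      have e : β / γ * (γ' * α') = β * α' * γ' / γ := by ring
      rw [e, div_lt_one hγ]
      nlinarith [mul_lt_one_of_nonneg_of_lt_one_left hβ0.le hβ1 hα1.le]
    refine nonpos_of_forall_le_mul_pow (B := K * ((1 + K) * (K' * ‖x‖))) (by positivity) hr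
      fun n => ?_
    have h1 := h.growth n _ (h.apply_eq_zero_of_sub 0 x)
    have h2 : ‖F n (x - P 0 x)‖ ≤ (1 + K) * ‖F n x‖ := by
      rw [map_sub, ← h.comm, add_mul, one_mul]
      exact (norm_sub_le _ _).trans (add_le_add le_rfl
        (((P n).le_opNorm _).trans (mul_le_mul_of_nonneg_right (h.bound n) (norm_nonneg _))))
    have h3 := h'.decay n x
    rw [hx] at h3
    calc ‖x - P 0 x‖ ≤ K * (β / γ) ^ n * ((1 + K) * (K' * (γ' * α') ^ n * ‖x‖)) := by
          refine h1.trans ?_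
          gcongr
          exact h2.trans (by gcongr)
      _ = _ := by rw [mul_pow]; ring
  exact (sub_eq_zero.1 (norm_le_zero_iff.1 key)).symm

lemma apply_eq_self_of_norm_le (h : GrowthSplitting F P γ K α β) {C : ℝ} (hC0 : 0 ≤ C)
    (hC : ∀ n x, ‖F n x‖ ≤ C ^ n * ‖x‖) (hlt : C < γ) (x : E) : P 0 x = x := by
  have key : ‖x - P 0 x‖ ≤ 0 := by
    have hγ := h.γ_pos
    have hK := h.K_pos
    obtain ⟨hβ0, hβ1⟩ := h.β_mem
    have hr : β / γ * C < 1 := by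
      rw [div_mul_eq_mul_div, div_lt_one hγ]
      nlinarith
    refine nonpos_of_forall_le_mul_pow (B := K * ‖x - P 0 x‖) (by positivity) hr fun n => ?_
    refine (h.growth n _ (h.apply_eq_zero_of_sub 0 x)).trans ?_
    calc K * (β / γ) ^ n * ‖F n (x - P 0 x)‖ ≤ K * (β / γ) ^ n * (C ^ n * ‖x - P 0 x‖) := by
          gcongr; exact hC n _
      _ = _ := by rw [mul_pow]; ring
  exact (sub_eq_zero.1 (norm_le_zero_iff.1 key)).symm

lemma eq_zero_of_norm_le (h : GrowthSplitting F P γ K α β) {C : ℝ} (hC0 : 0 ≤ C)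
    (hC : ∀ n x, ‖x‖ ≤ C ^ n * ‖F n x‖) (hlt : C * γ < 1) {x : E} (hx : P 0 x = x) : x = 0 := by
  refine norm_le_zero_iff.1 ?_
  have hγ := h.γ_pos
  have hK := h.K_pos
  obtain ⟨hα0, hα1⟩ := h.α_mem
  have hr : C * γ * α < 1 := by
    have : 0 ≤ C * γ := by positivity
    nlinarith
  refine nonpos_of_forall_le_mul_pow (B := K * ‖x‖) (by positivity) hr fun n => ?_
  have h1 := h.decay n x
  rw [hx] at h1
  calc ‖x‖ ≤ C ^ n * (K * (γ * α) ^ n * ‖x‖) := (hC n x).trans (by gcongr)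
    _ = _ := by rw [mul_pow, mul_pow, mul_pow]; ring

end GrowthSplitting

lemma exists_mem_resolventInterval {l : ℕ} {σm σp : Fin l → ℝ} (hpos : ∀ i, 0 < σm i)
    (hlt : ∀ i j, i < j → σp j < σm i) (i : Fin (l + 1)) : ∃ γ, γ ∈ resolventInterval σm σp i := by
  classical
  obtain ⟨γ, h1, h2⟩ := Order.exists_between_finsets
    (insert 0 ((Finset.univ.filter fun j : Fin l => i ≤ j.castSucc).image σp))
    ((Finset.univ.filter fun j : Fin l => j.castSucc < i).image σm) (by
      intro x hx y hy
      simp only [Finset.mem_insert, Finset.mem_image, Finset.mem_filter, Finset.mem_univ,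
        true_and] at hx hy
      obtain ⟨k, hk, rfl⟩ := hy
      rcases hx with rfl | ⟨j, hj, rfl⟩
      · exact hpos k
      · exact hlt k j (Fin.castSucc_lt_castSucc_iff.1 (hk.trans_le hj)))
  refine ⟨γ, h1 0 (by simp), fun j hj => h1 _ ?_, fun j hj => h2 _ ?_⟩
  · exact Finset.mem_insert_of_mem (Finset.mem_image_of_mem _ (by simpa using hj))
  · exact Finset.mem_image_of_mem _ (by simpa using hj)

lemma exists_mem_resolventInterval_zero_gt {l : ℕ} (σm σp : Fin l → ℝ) (C : ℝ) :
    ∃ γ ∈ resolventInterval σm σp 0, C < γ := by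
  obtain ⟨M, hM⟩ := (Set.finite_range σp).bddAbove
  refine ⟨max (max M C) 0 + 1, ⟨by positivity, fun j _ => ?_, fun j hj => ?_⟩, ?_⟩
  · have := hM ⟨j, rfl⟩
    linarith [le_max_left (max M C) 0, le_max_left M C]
  · exact absurd hj (Fin.not_lt_zero _)
  · linarith [le_max_left (max M C) 0, le_max_right M C]

lemma exists_mem_resolventInterval_last_lt {l : ℕ} {σm : Fin l → ℝ} (σp : Fin l → ℝ)
    (hpos : ∀ i, 0 < σm i) {c : ℝ} (hc : 0 < c) :
    ∃ γ ∈ resolventInterval σm σp (Fin.last l), γ < c := by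
  classical
  obtain ⟨γ, h1, h2⟩ := Order.exists_between_finsets {0} (insert c (Finset.univ.image σm)) (by
    intro x hx y hy
    simp only [Finset.mem_singleton, Finset.mem_insert, Finset.mem_image, Finset.mem_univ,
      true_and] at hx hy
    rcases hy with rfl | ⟨k, rfl⟩
    · rwa [hx]
    · rw [hx]; exact hpos k)
  refine ⟨γ, ⟨h1 0 (by simp), fun j hj => ?_, fun j _ => h2 _ (by simp)⟩, h2 c (by simp)⟩
  exact absurd (Fin.castSucc_lt_last j) (not_lt.2 hj)

/-- The properties of the projectors `P i` in the resolvent intervals on which the analysis of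
the solutions `n ↦ F n x` rests. -/
structure SpectralFiltration {l : ℕ} (F : ℕ → E →L[ℝ] E) (P : Fin (l + 1) → ℕ → E →L[ℝ] E) :
    Prop where
  bijective : ∀ n, Function.Bijective (F n)
  splitting : ∀ i, ∃ γ K α β, GrowthSplitting F (P i) γ K α β
  antitone : ∀ i : Fin l, ∀ x, P i.succ 0 x = x → P i.castSucc 0 x = x
  first : ∀ x, P 0 0 x = x
  last : ∀ x, P (Fin.last l) 0 x = 0

lemma IsSpectralData.spectralFiltration {l : ℕ} {A : ℕ → E →L[ℝ] E} {σm σp : Fin l → ℝ}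
    {P : Fin (l + 1) → ℕ → E →L[ℝ] E} (hA : BoundedInvertible A)
    (h : IsSpectralData A σm σp P) : SpectralFiltration (fun n => solOp A n 0) P := by
  obtain ⟨hu, C, hC⟩ := hA
  have hC0 : 0 ≤ C := (norm_nonneg _).trans (hC 0).1
  have hex (i : Fin (l + 1)) (γ : ℝ) (hγ : γ ∈ resolventInterval σm σp i) :
      ∃ K α β, GrowthSplitting (fun n => solOp A n 0) (P i) γ K α β := by
    obtain ⟨K, α, β, hd⟩ := h.projectors i γ hγ
    exact ⟨K, α, β, hd.growthSplitting hu hγ.1⟩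
  refine ⟨fun n => ⟨solOp_zero_injective hu n, solOp_zero_surjective hu n⟩, fun i => ?_,
    fun i x hx => ?_, fun x => ?_, fun x => ?_⟩
  · obtain ⟨γ, hγ⟩ := exists_mem_resolventInterval h.pos h.lt i
    exact ⟨γ, hex i γ hγ⟩
  · obtain ⟨γ, hγ⟩ := exists_mem_resolventInterval h.pos h.lt i.castSucc
    obtain ⟨γ', hγ'⟩ := exists_mem_resolventInterval h.pos h.lt i.succ
    obtain ⟨K, α, β, hs⟩ := hex _ γ hγ
    obtain ⟨K', α', β', hs'⟩ := hex _ γ' hγ'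
    refine hs.apply_eq_self_of_lt hs' ?_ hx
    exact ((hγ'.2.2 i (Fin.castSucc_lt_succ)).trans_le (h.le i)).trans (hγ.2.1 i le_rfl)
  · obtain ⟨γ, hγ, hlt⟩ := exists_mem_resolventInterval_zero_gt σm σp C
    obtain ⟨K, α, β, hs⟩ := hex _ γ hγ
    exact hs.apply_eq_self_of_norm_le hC0 (norm_solOp_zero_le fun n => (hC n).1) hlt x
  -- No nonzero solution decays faster than `C⁻ⁿ`, so a rate below `1 / C` has trivial stable range;
  -- `C + 1` avoids dividing by zero.
  · obtain ⟨γ, hγ, hlt⟩ := exists_mem_resolventInterval_last_lt σp h.pos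
      (c := 1 / (C + 1)) (by positivity)
    obtain ⟨K, α, β, hs⟩ := hex _ γ hγ
    refine hs.eq_zero_of_norm_le hC0 (norm_le_norm_solOp_zero hu fun n => (hC n).2) ?_ (hs.idem 0 x)
    rw [lt_div_iff₀ (by positivity)] at hlt
    nlinarith [hγ.1]

end Dichotomy

/-! ### Fiber projections and the dimension of trace spaces. -/

section TraceSpace

open Module

lemma sum_add_last_eq_of_castSucc_eq {M : Type*} [AddCommMonoid M] {l : ℕ}
    (f : Fin (l + 1) → M) (g : Fin l → M) (h : ∀ i, f i.castSucc = g i + f i.succ) :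
    ∑ i, g i + f (Fin.last l) = f 0 := by
  induction l with
  | zero => simp
  | succ l ih =>
    have := ih (fun i => f i.succ) (fun i => g i.succ) (fun i => h i.succ)
    rw [Fin.sum_univ_succ, add_assoc]
    rw [Fin.succ_last] at this
    rw [this]
    exact (h 0).symm

namespace SpectralFiltration

variable {l : ℕ} {F : ℕ → E →L[ℝ] E} {P : Fin (l + 1) → ℕ → E →L[ℝ] E}

lemma idem (h : SpectralFiltration F P) (i : Fin (l + 1)) (n : ℕ) (x : E) :
    P i n (P i n x) = P i n x := by
  obtain ⟨_, _, _, _, hs⟩ := h.splitting i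
  exact hs.idem n x

lemma comm (h : SpectralFiltration F P) (i : Fin (l + 1)) (n : ℕ) (x : E) :
    P i n (F n x) = F n (P i 0 x) := by
  obtain ⟨_, _, _, _, hs⟩ := h.splitting i
  exact hs.comm n x

lemma exists_bound (h : SpectralFiltration F P) (i : Fin (l + 1)) :
    ∃ K, 0 ≤ K ∧ ∀ n, ‖P i n‖ ≤ K := by
  obtain ⟨_, K, _, _, hs⟩ := h.splitting i
  exact ⟨K, hs.K_pos.le, hs.bound⟩

lemma mem_range_iff (h : SpectralFiltration F P) (i : Fin (l + 1)) (n : ℕ) (x : E) :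
    x ∈ LinearMap.range (P i n).toLinearMap ↔ P i n x = x := by
  constructor
  · rintro ⟨y, rfl⟩
    exact h.idem i n y
  · exact fun hx => ⟨x, hx⟩

lemma mem_range_one_sub_iff (h : SpectralFiltration F P) (i : Fin (l + 1)) (n : ℕ) (x : E) :
    x ∈ LinearMap.range (1 - P i n).toLinearMap ↔ P i n x = 0 := by
  constructor
  · rintro ⟨y, rfl⟩
    simp [h.idem i n y]
  · exact fun hx => ⟨x, by simp [hx]⟩

lemma mem_fiber_iff (h : SpectralFiltration F P) (n : ℕ) (i : Fin l) (x : E) :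
    x ∈ fiber P n i ↔ P i.castSucc n x = x ∧ P i.succ n x = 0 := by
  rw [fiber, Submodule.mem_inf, h.mem_range_iff, h.mem_range_one_sub_iff]

lemma map_fiber_zero (h : SpectralFiltration F P) (n : ℕ) (i : Fin l) :
    (fiber P 0 i).map (F n).toLinearMap = fiber P n i := by
  ext y
  rw [Submodule.mem_map, h.mem_fiber_iff]
  constructor
  · rintro ⟨x, hx, rfl⟩
    obtain ⟨h1, h2⟩ := (h.mem_fiber_iff 0 i x).1 hx
    simp [h.comm, h1, h2]
  · rintro ⟨h1, h2⟩
    obtain ⟨x, rfl⟩ := (h.bijective n).2 y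
    rw [h.comm] at h1 h2
    refine ⟨x, (h.mem_fiber_iff 0 i x).2 ⟨(h.bijective n).1 h1, (h.bijective n).1 ?_⟩, rfl⟩
    rw [h2, map_zero]

lemma stable_antitone (h : SpectralFiltration F P) {i j : Fin (l + 1)} (hij : i ≤ j) {x : E}
    (hx : P j 0 x = x) : P i 0 x = x := by
  induction j using Fin.induction with
  | zero => rwa [Fin.le_zero_iff.1 hij]
  | succ j ih =>
    rcases hij.eq_or_lt with rfl | hlt
    · exact hx
    · exact ih (Fin.le_castSucc_iff.2 hlt) (h.antitone j x hx)

/-- `R` is the product `P k ⋯ P 1`. Nested stable ranges make every factor fix the range of `P k`.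
On the fiber `j < k` the factors up to `P j` act as the identity and the next one gives zero. No
nesting of unstable ranges is needed. -/
lemma exists_partial_fiberProjection (h : SpectralFiltration F P) (k : Fin (l + 1)) :
    ∃ (B : ℝ) (R : ℕ → E →L[ℝ] E), 0 ≤ B ∧ (∀ n, ‖R n‖ ≤ B) ∧ (∀ n x, R n (F n x) = F n (R 0 x)) ∧
      (∀ x, P k 0 x = x → R 0 x = x) ∧
      ∀ j : Fin l, j.castSucc < k → ∀ x ∈ fiber P 0 j, R 0 x = 0 := by
  induction k using Fin.induction with
  | zero =>
    refine ⟨‖(1 : E →L[ℝ] E)‖, fun _ => 1, norm_nonneg _, fun _ => le_rfl, fun _ _ => rfl,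
      fun _ _ => rfl, fun j hj => absurd hj (Fin.not_lt_zero _)⟩
  | succ k ih =>
    obtain ⟨B, R, hB, hR, hcomm, hid, hz⟩ := ih
    obtain ⟨K, hK, hKP⟩ := h.exists_bound k.succ
    refine ⟨K * B, fun n => P k.succ n * R n, by positivity, fun n => ?_, fun n x => ?_,
      fun x hx => ?_, fun j hj x hx => ?_⟩
    · exact (norm_mul_le _ _).trans (mul_le_mul (hKP n) (hR n) (norm_nonneg _) hK)
    · simp only [mul_apply_eq_comp, hcomm, h.comm]
    · rw [mul_apply_eq_comp, hid x (h.antitone k x hx), hx]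
    · rw [mul_apply_eq_comp]
      obtain ⟨h1, h2⟩ := (h.mem_fiber_iff 0 j x).1 hx
      rcases (Fin.le_castSucc_iff.2 hj).eq_or_lt with he | hlt
      · obtain rfl := Fin.castSucc_injective _ he
        rw [hid x h1, h2]
      · rw [hz j hlt x hx, map_zero]

/-- The projections onto the fibers along the other fibers are bounded uniformly in time. -/
lemma exists_fiberProjection (h : SpectralFiltration F P) (i : Fin l) :
    ∃ (B : ℝ) (Q : ℕ → E →L[ℝ] E), 0 ≤ B ∧ (∀ n, ‖Q n‖ ≤ B) ∧ (∀ n x, Q n (F n x) = F n (Q 0 x)) ∧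
      (∀ x ∈ fiber P 0 i, Q 0 x = x) ∧ ∀ j, j ≠ i → ∀ x ∈ fiber P 0 j, Q 0 x = 0 := by
  obtain ⟨B, R, hB, hR, hcomm, hid, hz⟩ := h.exists_partial_fiberProjection i.castSucc
  obtain ⟨K, hK, hKP⟩ := h.exists_bound i.succ
  refine ⟨B + K * B, fun n => R n - P i.succ n * R n, by positivity, fun n => ?_, fun n x => ?_,
    fun x hx => ?_, fun j hj x hx => ?_⟩
  · exact (norm_sub_le _ _).trans (add_le_add (hR n)
      ((norm_mul_le _ _).trans (mul_le_mul (hKP n) (hR n) (norm_nonneg _) hK)))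
  · simp only [sub_apply, mul_apply_eq_comp, hcomm, h.comm, map_sub]
  · obtain ⟨h1, h2⟩ := (h.mem_fiber_iff 0 i x).1 hx
    rw [sub_apply, mul_apply_eq_comp, hid x h1, h2, sub_zero]
  · obtain ⟨h1, h2⟩ := (h.mem_fiber_iff 0 j x).1 hx
    rw [sub_apply, mul_apply_eq_comp]
    rcases lt_or_gt_of_ne hj with hlt | hgt
    · rw [hz j (Fin.castSucc_lt_castSucc_iff.2 hlt) x hx, map_zero, sub_zero]
    -- Fibers of index above `i` lie in the stable range of `P i.succ`, where `R` and `P i.succ`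
    -- both act as the identity.
    · have h3 : P i.succ 0 x = x :=
        h.stable_antitone (Fin.succ_le_castSucc_iff.2 hgt) h1
      rw [hid x (h.antitone i x h3), h3, sub_self]

lemma iSupIndep_fiber (h : SpectralFiltration F P) : iSupIndep (fiber P 0) := by
  rw [iSupIndep_def]
  intro i
  obtain ⟨B, Q, -, -, -, hid, hz⟩ := h.exists_fiberProjection i
  rw [Submodule.disjoint_def]
  intro x hx hx'
  rw [← hid x hx]
  have hle : (⨆ j, ⨆ (_ : j ≠ i), fiber P 0 j) ≤ LinearMap.ker (Q 0).toLinearMap :=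
    iSup₂_le fun j hj y hy => hz j hj y hy
  exact hle hx'

/-- The summand of the trace space in the `i`-th fiber. -/
lemma map_le_fiber (h : SpectralFiltration F P) (V : Submodule ℝ E) (i : Fin l) :
    (LinearMap.range (P i.castSucc 0).toLinearMap ⊓ V).map (1 - P i.succ 0).toLinearMap
      ≤ fiber P 0 i := by
  rintro _ ⟨x, ⟨hx, -⟩, rfl⟩
  have hx' : P i.castSucc 0 x = x := (h.mem_range_iff _ _ _).1 hx
  rw [h.mem_fiber_iff]
  have h1 : P i.castSucc 0 (P i.succ 0 x) = P i.succ 0 x := h.antitone i _ (h.idem _ _ _)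
  simp [hx', h1, h.idem]

variable [FiniteDimensional ℝ E]

/-- Rank-nullity for `1 - P i.succ 0` on the larger intersection: its kernel there is the next,
smaller one. -/
lemma finrank_range_inf (h : SpectralFiltration F P) (V : Submodule ℝ E) (i : Fin l) :
    finrank ℝ ↥(LinearMap.range (P i.castSucc 0).toLinearMap ⊓ V) =
      finrank ℝ ↥((LinearMap.range (P i.castSucc 0).toLinearMap ⊓ V).map
        (1 - P i.succ 0).toLinearMap) +
      finrank ℝ ↥(LinearMap.range (P i.succ 0).toLinearMap ⊓ V) := by
  set S := LinearMap.range (P i.castSucc 0).toLinearMap ⊓ V with hS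
  set S' := LinearMap.range (P i.succ 0).toLinearMap ⊓ V with hS'
  have hle : S' ≤ S := by
    rintro x ⟨hx, hxV⟩
    exact ⟨(h.mem_range_iff _ _ _).2 (h.antitone i x ((h.mem_range_iff _ _ _).1 hx)), hxV⟩
  rw [← LinearMap.finrank_range_add_finrank_ker ((1 - P i.succ 0).toLinearMap.domRestrict S),
    LinearMap.range_domRestrict]
  congr 1
  have hker : LinearMap.ker ((1 - P i.succ 0).toLinearMap.domRestrict S) = S'.comap S.subtype := by
    ext ⟨x, hx⟩
    rw [LinearMap.mem_ker, Submodule.mem_comap, hS', Submodule.mem_inf, h.mem_range_iff]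
    simp only [LinearMap.domRestrict_apply, Submodule.subtype_apply]
    have hxV : x ∈ V := hx.2
    rw [and_iff_left hxV]
    exact (sub_eq_zero (a := x) (b := P i.succ 0 x)).trans eq_comm
  rw [hker]
  exact (Submodule.comapSubtypeEquivOfLe hle).finrank_eq

lemma sum_finrank_map (h : SpectralFiltration F P) (V : Submodule ℝ E) :
    ∑ i : Fin l, finrank ℝ ↥((LinearMap.range (P i.castSucc 0).toLinearMap ⊓ V).map
      (1 - P i.succ 0).toLinearMap) = finrank ℝ V := by
  have key := sum_add_last_eq_of_castSucc_eq
    (fun i => finrank ℝ ↥(LinearMap.range (P i 0).toLinearMap ⊓ V)) _ (h.finrank_range_inf V)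
  have h0 : LinearMap.range (P 0 0).toLinearMap = ⊤ :=
    eq_top_iff.2 fun x _ => (h.mem_range_iff _ _ _).2 (h.first x)
  have hl : LinearMap.range (P (Fin.last l) 0).toLinearMap = ⊥ := by
    rw [LinearMap.range_eq_bot]
    ext x
    exact h.last x
  rw [h0, hl, bot_inf_eq, top_inf_eq, finrank_bot, add_zero] at key
  exact key

lemma traceSpace_mem_traceSpaces (h : SpectralFiltration F P) (V : Submodule ℝ E) :
    traceSpace P 0 V ∈ traceSpaces P 0 (finrank ℝ V) :=
  ⟨_, h.map_le_fiber V, h.iSupIndep_fiber.mono (h.map_le_fiber V), rfl, h.sum_finrank_map V⟩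

end SpectralFiltration

lemma finrank_eq_of_mem_traceSpaces {l : ℕ} [FiniteDimensional ℝ E]
    {P : Fin (l + 1) → ℕ → E →L[ℝ] E} {k s : ℕ} {V : Submodule ℝ E} (hV : V ∈ traceSpaces P k s) :
    finrank ℝ V = s := by
  obtain ⟨U, -, hind, rfl, hs⟩ := hV
  rw [← hs, Submodule.iSup_eq_range_dfinsupp_lsum,
    LinearMap.finrank_range_of_inj hind.dfinsupp_lsum_injective]
  exact Module.finrank_directSum ℝ fun i => U i

end TraceSpace

/-! ### Asymptotic closeness of a subspace and its trace space. -/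

section Asymptotics

open Module

lemma exists_section_of_map [FiniteDimensional ℝ E] (f : E →ₗ[ℝ] E) (S : Submodule ℝ E) :
    ∃ r : E →L[ℝ] E, ∀ w ∈ S.map f, r w ∈ S ∧ f (r w) = w := by
  have hsurj : LinearMap.range (f.submoduleMap S) = ⊤ :=
    LinearMap.range_eq_top.2 (f.submoduleMap_surjective S)
  obtain ⟨g, hg⟩ := (f.submoduleMap S).exists_rightInverse_of_surjective hsurj
  obtain ⟨r, hr⟩ := LinearMap.exists_extend (S.subtype ∘ₗ g)
  refine ⟨r.toContinuousLinearMap, fun w hw => ?_⟩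
  have h1 : r w = (g ⟨w, hw⟩ : E) := DFunLike.congr_fun hr ⟨w, hw⟩
  have h2 := congrArg Subtype.val (DFunLike.congr_fun hg ⟨w, hw⟩)
  rw [LinearMap.coe_toContinuousLinearMap', h1]
  exact ⟨(g ⟨w, hw⟩).2, h2⟩

namespace SpectralFiltration

variable {l : ℕ} {F : ℕ → E →L[ℝ] E} {P : Fin (l + 1) → ℕ → E →L[ℝ] E}

lemma traceSpace_le_of_le (h : SpectralFiltration F P) {V M : Submodule ℝ E}
    {T : Submodule ℝ E} (hT : T = traceSpace P 0 V)
    (hM : ∀ i, ∀ x ∈ fiber P 0 i, x ∈ (LinearMap.range (P i.castSucc 0).toLinearMap ⊓ V).map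
      (1 - P i.succ 0).toLinearMap → x ∈ M) : T ≤ M := by
  rw [hT]
  exact iSup_le fun i x hx => hM i x (h.map_le_fiber V i hx) hx

lemma map_ne_bot (h : SpectralFiltration F P) {V : Submodule ℝ E} (hV : V ≠ ⊥) (n : ℕ) :
    V.map (F n).toLinearMap ≠ ⊥ := fun h0 =>
  hV (Submodule.map_injective_of_injective (f := (F n).toLinearMap) (h.bijective n).1
    (by rw [h0, Submodule.map_bot]))

variable [FiniteDimensional ℝ E]

/-- `Q` extracts the component `u` in the `i`-th fiber, and `g` lifts it into `V` by a fixed linear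
section. The error lies in the range of `P i.succ 0` and is at most of order `(γ * α) ^ n`, while
the orbit of `u` is at least of order `(γ / β) ^ n`; the rate `γ` cancels and `(α * β) ^ n` remains.
-/
lemma exists_lift_component (h : SpectralFiltration F P) (V : Submodule ℝ E) (i : Fin l) :
    ∃ (g Q : E →ₗ[ℝ] E) (ε : ℕ → ℝ), Tendsto ε atTop (𝓝 0) ∧
      (∀ x ∈ fiber P 0 i, Q x = x) ∧ (∀ j, j ≠ i → ∀ x ∈ fiber P 0 j, Q x = 0) ∧
      (∀ w ∈ traceSpace P 0 V, g w ∈ V) ∧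
      ∀ n, ∀ w ∈ traceSpace P 0 V, ‖F n (g w - Q w)‖ ≤ ε n * ‖F n w‖ := by
  obtain ⟨B, Q, hB, hQB, hcomm, hid, hz⟩ := h.exists_fiberProjection i
  set S := LinearMap.range (P i.castSucc 0).toLinearMap ⊓ V
  obtain ⟨r, hr⟩ := exists_section_of_map (1 - P i.succ 0).toLinearMap S
  obtain ⟨γ, K, α, β, hs⟩ := h.splitting i.succ
  have hγ := hs.γ_pos
  have hK := hs.K_pos
  obtain ⟨hα0, hα1⟩ := hs.α_mem
  obtain ⟨hβ0, hβ1⟩ := hs.β_mem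
  have hQT : ∀ w ∈ traceSpace P 0 V, Q 0 w ∈ S.map (1 - P i.succ 0).toLinearMap := by
    have hle : traceSpace P 0 V ≤
        (S.map (1 - P i.succ 0).toLinearMap).comap (Q 0).toLinearMap := by
      refine h.traceSpace_le_of_le rfl fun j x hx hx' => ?_
      rw [Submodule.mem_comap]
      rcases eq_or_ne j i with rfl | hj
      · rw [ContinuousLinearMap.coe_coe, hid x hx]
        exact hx'
      · rw [ContinuousLinearMap.coe_coe, hz j hj x hx]
        exact Submodule.zero_mem _
    exact fun w hw => hle hw
  refine ⟨(r * Q 0).toLinearMap, (Q 0).toLinearMap,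
    fun n => K * K * ‖r‖ * B * (α * β) ^ n, ?_, hid, hz, fun w hw => (hr _ (hQT w hw)).1.2,
    fun n w hw => ?_⟩
  · have hr1 : α * β < 1 := mul_lt_one_of_nonneg_of_lt_one_left hα0.le hα1 hβ1.le
    simpa using (tendsto_pow_atTop_nhds_zero_of_lt_one (by positivity) hr1).const_mul
      (K * K * ‖r‖ * B)
  · set u := Q 0 w with hu
    have h1 : r u - P i.succ 0 (r u) = u := (hr u (hQT w hw)).2
    have h2 : P i.succ 0 u = 0 := ((h.mem_fiber_iff 0 i u).1 (h.map_le_fiber V i (hQT w hw))).2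
    have h3 : (r * Q 0).toLinearMap w - (Q 0).toLinearMap w = P i.succ 0 (r u) := by
      change r u - u = _
      rw [sub_eq_iff_eq_add, ← sub_eq_iff_eq_add', h1]
    -- The uniform bound on the fiber projections at time `n` enters here: passing to one component
    -- costs only the factor `B`.
    have h4 : ‖F n u‖ ≤ B * ‖F n w‖ := by
      rw [hu, ← hcomm]
      exact ((Q n).le_opNorm _).trans (mul_le_mul_of_nonneg_right (hQB n) (norm_nonneg _))
    rw [h3]
    calc ‖F n (P i.succ 0 (r u))‖ ≤ K * (γ * α) ^ n * ‖r u‖ := hs.decay n _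
      _ ≤ K * (γ * α) ^ n * (‖r‖ * (K * (β / γ) ^ n * (B * ‖F n w‖))) := by
        gcongr
        refine (r.le_opNorm u).trans ?_
        gcongr
        exact (hs.growth n u h2).trans (by gcongr)
      _ = K * K * ‖r‖ * B * (γ * α * (β / γ)) ^ n * ‖F n w‖ := by rw [mul_pow _ (β / γ)]; ring
      _ = _ := by
        congr 3
        field_simp

/-- `V` is asymptotically a graph over its trace space. -/
lemma exists_lift (h : SpectralFiltration F P) (V : Submodule ℝ E) :
    ∃ (G : E →ₗ[ℝ] E) (ε : ℕ → ℝ), Tendsto ε atTop (𝓝 0) ∧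
      (∀ w ∈ traceSpace P 0 V, G w ∈ V) ∧
      ∀ n, ∀ w ∈ traceSpace P 0 V, ‖F n (G w - w)‖ ≤ ε n * ‖F n w‖ := by
  choose g Q ε hε hid hz hg hest using h.exists_lift_component V
  have hsum : ∀ w ∈ traceSpace P 0 V, ∑ i, Q i w = w := by
    have hle : traceSpace P 0 V ≤ LinearMap.eqLocus (∑ i, Q i) LinearMap.id := by
      refine h.traceSpace_le_of_le rfl fun j x hx _ => ?_
      rw [LinearMap.mem_eqLocus, LinearMap.sum_apply, LinearMap.id_apply,
        Finset.sum_eq_single j (fun i _ hij => hz i j hij.symm x hx) (by simp), hid j x hx]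
    intro w hw
    simpa [LinearMap.mem_eqLocus] using hle hw
  refine ⟨∑ i, g i, fun n => ∑ i, ε i n, ?_, fun w hw => ?_, fun n w hw => ?_⟩
  · simpa using tendsto_finsetSum Finset.univ fun i _ => hε i
  · rw [LinearMap.sum_apply]
    exact Submodule.sum_mem _ fun i _ => hg i w hw
  · have : (∑ i, g i) w - w = ∑ i, (g i w - Q i w) := by
      rw [Finset.sum_sub_distrib, hsum w hw, LinearMap.sum_apply]
    rw [this, map_sum, Finset.sum_mul]
    exact norm_sum_le_of_le _ fun i _ => hest i n w hw

lemma finrank_traceSpace (h : SpectralFiltration F P) (V : Submodule ℝ E) :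
    finrank ℝ (traceSpace P 0 V) = finrank ℝ V :=
  finrank_eq_of_mem_traceSpaces (h.traceSpace_mem_traceSpaces V)

lemma traceSpace_ne_bot (h : SpectralFiltration F P) {V : Submodule ℝ E} (hV : V ≠ ⊥) :
    traceSpace P 0 V ≠ ⊥ := fun h0 => hV <| by
  rw [← Submodule.finrank_eq_zero (R := ℝ), ← h.finrank_traceSpace, h0, finrank_bot]

/-- The images of `V` and of its trace space become arbitrarily close. -/
lemma exists_tendsto_ang_le (h : SpectralFiltration F P) {V : Submodule ℝ E} (hV : V ≠ ⊥) :
    ∃ δ : ℕ → ℝ, Tendsto δ atTop (𝓝 0) ∧ ∀ᶠ n in atTop,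
      ang (V.map (F n).toLinearMap) ((traceSpace P 0 V).map (F n).toLinearMap) ≤ δ n ∧
      ang ((traceSpace P 0 V).map (F n).toLinearMap) (V.map (F n).toLinearMap) ≤ δ n := by
  obtain ⟨G, ε, hε, hG, hest⟩ := h.exists_lift V
  set T := traceSpace P 0 V
  refine ⟨fun n => Real.arccos (1 - (2 * ε n) ^ 2 / 2), ?_, ?_⟩
  · have h1 : Tendsto (fun n => 1 - (2 * ε n) ^ 2 / 2) atTop (𝓝 1) := by
      simpa using (((hε.const_mul 2).pow 2).div_const 2).const_sub 1
    have h2 := (Real.continuous_arccos.tendsto 1).comp h1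
    rwa [Real.arccos_one] at h2
  -- Below `1 / 2`, `G` is injective on `T`, hence onto `V` by dimension, and `‖F n w‖ ≤ 2 * ‖F n (G
  -- w)‖`. This is where the factor in `2 * ε n` comes from.
  have hev : ∀ᶠ n in atTop, ε n < 1 / 2 := hε.eventually_lt_const (by norm_num)
  filter_upwards [hev] with n hn
  have hinj : ∀ w ∈ T, G w = 0 → w = 0 := by
    intro w hw hGw
    have h1 := hest n w hw
    rw [hGw, zero_sub, map_neg, norm_neg] at h1
    have h2 : ‖F n w‖ = 0 := by nlinarith [norm_nonneg (F n w)]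
    exact (h.bijective n).1 (by rw [norm_eq_zero.1 h2, map_zero])
  have hmap : T.map G = V := by
    refine Submodule.eq_of_le_of_finrank_eq (Submodule.map_le_iff_le_comap.2 hG) ?_
    rw [← LinearMap.range_domRestrict, LinearMap.finrank_range_of_inj, h.finrank_traceSpace]
    rw [← LinearMap.ker_eq_bot, LinearMap.ker_eq_bot']
    rintro ⟨w, hw⟩ h0
    exact Subtype.ext (hinj w hw h0)
  have hclose : ∀ w ∈ T, ‖F n w - F n (G w)‖ ≤ 2 * ε n * ‖F n w‖ ∧
      ‖F n w - F n (G w)‖ ≤ 2 * ε n * ‖F n (G w)‖ := by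
    intro w hw
    have h1 := hest n w hw
    rw [map_sub, norm_sub_rev] at h1
    have h2 := norm_sub_norm_le (F n w) (F n (G w))
    have h3 : 0 ≤ ‖F n w‖ := norm_nonneg _
    have h4 : 0 ≤ ε n * ‖F n w‖ := (norm_nonneg _).trans h1
    refine ⟨by nlinarith, ?_⟩
    rcases le_or_gt 0 (ε n) with h5 | h5
    · nlinarith
    · have h6 : ‖F n w‖ = 0 := by nlinarith
      have h7 : w = 0 := (h.bijective n).1 (by rw [norm_eq_zero.1 h6, map_zero])
      simp [h7]
  have h2ε : 2 * ε n < 1 := by linarith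
  constructor
  · refine ang_le_arccos_of_close (h.map_ne_bot (h.traceSpace_ne_bot hV) n) h2ε ?_
    rintro _ ⟨w, hw, rfl⟩
    exact ⟨F n (G w), ⟨G w, hG w hw, rfl⟩, hclose w hw⟩
  · refine ang_le_arccos_of_close (h.map_ne_bot hV n) h2ε ?_
    rintro _ ⟨v, hv, rfl⟩
    obtain ⟨w, hw, rfl⟩ := hmap.ge hv
    refine ⟨F n w, ⟨w, hw, rfl⟩, ?_⟩
    rw [norm_sub_rev]
    exact (hclose w hw).symm

end SpectralFiltration

/-- Sequences of averages whose terms become close have the same `limsup` and `liminf`. -/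
lemma limsup_eq_and_liminf_eq_of_tendsto_sub {u v : ℕ → ℝ} {M : ℝ} (hu : ∀ n, |u n| ≤ M)
    (hv : ∀ n, |v n| ≤ M) (h : Tendsto (fun n => u n - v n) atTop (𝓝 0)) :
    limsup u atTop = limsup v atTop ∧ liminf u atTop = liminf v atTop := by
  have hb {w : ℕ → ℝ} (hw : ∀ n, |w n| ≤ M) : IsBoundedUnder (· ≤ ·) atTop w ∧
      IsBoundedUnder (· ≥ ·) atTop w :=
    ⟨isBoundedUnder_of ⟨M, fun n => (abs_le.1 (hw n)).2⟩,
      isBoundedUnder_of ⟨-M, fun n => (abs_le.1 (hw n)).1⟩⟩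
  have key {u v : ℕ → ℝ} (hu : ∀ n, |u n| ≤ M) (hv : ∀ n, |v n| ≤ M)
      (h : Tendsto (fun n => u n - v n) atTop (𝓝 0)) :
      limsup u atTop ≤ limsup v atTop ∧ liminf u atTop ≤ liminf v atTop := by
    have hle (ε : ℝ) (hε : 0 < ε) : ∀ᶠ n in atTop, u n ≤ v n + ε := by
      filter_upwards [h.eventually_lt_const hε] with n hn
      linarith
    have hvε (ε : ℝ) (hε : 0 < ε) (n : ℕ) : |v n + ε| ≤ M + ε :=
      (abs_add_le _ _).trans (by rw [abs_of_pos hε]; exact add_le_add (hv n) le_rfl)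
    constructor
    · refine le_of_forall_pos_le_add fun ε hε => ?_
      rw [← limsup_add_const atTop v ε (hb hv).1 (hb hv).2.isCoboundedUnder_le]
      refine limsup_le_limsup (hle ε hε) (hb hu).2.isCoboundedUnder_le ?_
      exact isBoundedUnder_of ⟨M + ε, fun n => (abs_le.1 (hvε ε hε n)).2⟩
    · refine le_of_forall_pos_le_add fun ε hε => ?_
      rw [← liminf_add_const atTop v ε (hb hv).1.isCoboundedUnder_ge (hb hv).2]
      refine liminf_le_liminf (hle ε hε) (hb hu).2 ?_
      exact (isBoundedUnder_of ⟨M + ε, fun n => (abs_le.1 (hvε ε hε n)).2⟩ :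
        IsBoundedUnder (· ≤ ·) atTop _).isCoboundedUnder_ge
  have h' : Tendsto (fun n => v n - u n) atTop (𝓝 0) := by simpa using h.neg
  exact ⟨le_antisymm (key hu hv h).1 (key hv hu h').1, le_antisymm (key hu hv h).2 (key hv hu h').2⟩

variable [FiniteDimensional ℝ E]

lemma abs_avg_angSum_le (A : ℕ → E →L[ℝ] E) (V : Submodule ℝ E) (n : ℕ) :
    |1 / (n : ℝ) * angSum A 1 n V| ≤ Real.pi / 2 := by
  rw [angSum, abs_of_nonneg (mul_nonneg (by positivity) (Finset.sum_nonneg fun _ _ => ang_nonneg _ _))]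
  rcases Nat.eq_zero_or_pos n with rfl | hn
  · rw [Nat.cast_zero, div_zero, zero_mul]
    exact Real.pi_div_two_pos.le
  · rw [one_div_mul_eq_div, div_le_iff₀ (by positivity)]
    refine (Finset.sum_le_card_nsmul _ _ _ fun _ _ => ang_le_pi_div_two _ _).trans_eq ?_
    simp [mul_comm]

lemma angSum_one_eq_sum_range (A : ℕ → E →L[ℝ] E) (V : Submodule ℝ E) (n : ℕ) :
    angSum A 1 n V = ∑ j ∈ Finset.range n, ang (V.map (solOp A j 0).toLinearMap)
      (V.map (solOp A (j + 1) 0).toLinearMap) := by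
  rw [Finset.range_eq_Ico]
  exact (Finset.sum_Ico_add' (fun j => ang (V.map (solOp A (j - 1) 0).toLinearMap)
    (V.map (solOp A j 0).toLinearMap)) 0 n 1).symm

/-- Two triangle inequalities in each direction bound the difference of the `j`-th summands by `δ j
+ δ (j + 1)`. Both orders of the arguments of `ang` are used, so its symmetry is not needed. -/
lemma SpectralFiltration.limsupAvg_eq_and_liminfAvg_eq {l : ℕ} {A : ℕ → E →L[ℝ] E}
    {P : Fin (l + 1) → ℕ → E →L[ℝ] E} (h : SpectralFiltration (fun n => solOp A n 0) P)
    {V : Submodule ℝ E} (hV : V ≠ ⊥) :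
    limsupAvg A V = limsupAvg A (traceSpace P 0 V) ∧
      liminfAvg A V = liminfAvg A (traceSpace P 0 V) := by
  refine limsup_eq_and_liminf_eq_of_tendsto_sub (abs_avg_angSum_le A V)
    (abs_avg_angSum_le A (traceSpace P 0 V)) ?_
  obtain ⟨δ, hδ, hle⟩ := h.exists_tendsto_ang_le hV
  set T := traceSpace P 0 V
  set a : Submodule ℝ E → ℕ → ℝ := fun V j =>
    ang (V.map (solOp A j 0).toLinearMap) (V.map (solOp A (j + 1) 0).toLinearMap)
  have hT := h.traceSpace_ne_bot hV
  have hterm : Tendsto (fun j => a V j - a T j) atTop (𝓝 0) := by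
    refine squeeze_zero_norm' (a := fun j => δ j + δ (j + 1)) ?_ ?_
    · filter_upwards [hle, (tendsto_add_atTop_nat 1).eventually hle] with j h1 h2
      have t1 := ang_triangle (V.map (solOp A j 0).toLinearMap) (T.map (solOp A j 0).toLinearMap)
        (h.map_ne_bot hV (j + 1))
      have t2 := ang_triangle (T.map (solOp A j 0).toLinearMap)
        (T.map (solOp A (j + 1) 0).toLinearMap) (h.map_ne_bot hV (j + 1))
      have t3 := ang_triangle (T.map (solOp A j 0).toLinearMap) (V.map (solOp A j 0).toLinearMap)
        (h.map_ne_bot hT (j + 1))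
      have t4 := ang_triangle (V.map (solOp A j 0).toLinearMap)
        (V.map (solOp A (j + 1) 0).toLinearMap) (h.map_ne_bot hT (j + 1))
      rw [Real.norm_eq_abs, abs_le]
      constructor <;> simp only [a] <;> linarith [h1.1, h1.2, h2.1, h2.2]
    · simpa using hδ.add ((tendsto_add_atTop_iff_nat 1).2 hδ)
  refine hterm.cesaro.congr fun n => ?_
  rw [angSum_one_eq_sum_range, angSum_one_eq_sum_range, ← mul_sub, ← Finset.sum_sub_distrib,
    one_div]

end Asymptotics

/-! ### Reduction of the suprema to trace spaces and to fibers. -/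

section OuterAngularValues

open Module

lemma ne_bot_of_mem_grassmannian {s : ℕ} (hs : 1 ≤ s) {V : Submodule ℝ E}
    (hV : V ∈ grassmannian E s) : V ≠ ⊥ := by
  rintro rfl
  rw [grassmannian, Set.mem_ofPred_eq, finrank_bot] at hV
  omega

variable [FiniteDimensional ℝ E] {l : ℕ} {A : ℕ → E →L[ℝ] E} {P : Fin (l + 1) → ℕ → E →L[ℝ] E}

/-- Some summand is nonzero, so it fills its one-dimensional fiber and exhausts the total dimension.
-/
lemma eq_fiber_of_mem_traceSpaces_one {k : ℕ} (hfib : ∀ i, finrank ℝ (fiber P k i) = 1)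
    {V : Submodule ℝ E} (hV : V ∈ traceSpaces P k 1) : ∃ i, V = fiber P k i := by
  have hfin := finrank_eq_of_mem_traceSpaces hV
  obtain ⟨U, hU, -, rfl, hs⟩ := hV
  obtain ⟨i, -, hi⟩ := Finset.exists_ne_zero_of_sum_ne_zero (hs.trans_ne one_ne_zero)
  have h1 := Submodule.finrank_mono (hU i)
  have h2 := hfib i
  have hUi : U i = fiber P k i := Submodule.eq_of_le_of_finrank_eq (hU i) (by omega)
  refine ⟨i, (Submodule.eq_of_le_of_finrank_eq ?_ ?_).symm⟩
  · rw [← hUi]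
    exact le_iSup U i
  · rw [hfin, h2]

namespace SpectralFiltration

lemma image_grassmannian_eq (h : SpectralFiltration (fun n => solOp A n 0) P) {s : ℕ}
    {f : Submodule ℝ E → ℝ} (hf : ∀ V ∈ grassmannian E s, f V = f (traceSpace P 0 V)) :
    f '' grassmannian E s = f '' traceSpaces P 0 s := by
  refine Set.Subset.antisymm ?_ (Set.image_mono fun V hV => finrank_eq_of_mem_traceSpaces hV)
  rintro _ ⟨V, hV, rfl⟩
  refine ⟨_, ?_, (hf V hV).symm⟩
  have := h.traceSpace_mem_traceSpaces V
  rwa [show finrank ℝ V = s from hV] at this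

lemma angSum_fiber (h : SpectralFiltration (fun n => solOp A n 0) P) (i : Fin l) (m n : ℕ) :
    angSum A m n (fiber P 0 i) =
      ∑ j ∈ Finset.Icc m n, ang (fiber P (j - 1) i) (fiber P j i) :=
  Finset.sum_congr rfl fun j _ => by rw [h.map_fiber_zero, h.map_fiber_zero]

/-- The values on lines are exactly the finitely many values on fibers; the set is nonempty because
`E` contains a line, so its supremum is attained. -/
lemma isGreatest_range_fiber [Nontrivial E] (h : SpectralFiltration (fun n => solOp A n 0) P)
    (hfib : ∀ i, finrank ℝ (fiber P 0 i) = 1) {f : Submodule ℝ E → ℝ}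
    (hf : ∀ V ∈ grassmannian E 1, f V = f (traceSpace P 0 V)) :
    IsGreatest (Set.range fun i => f (fiber P 0 i)) (sSup (f '' grassmannian E 1)) := by
  have heq : f '' grassmannian E 1 = Set.range fun i => f (fiber P 0 i) := by
    refine Set.Subset.antisymm ?_ ?_
    · rw [h.image_grassmannian_eq hf]
      rintro _ ⟨V, hV, rfl⟩
      obtain ⟨i, rfl⟩ := eq_fiber_of_mem_traceSpaces_one hfib hV
      exact ⟨i, rfl⟩
    · rintro _ ⟨i, rfl⟩
      exact ⟨_, hfib i, rfl⟩
  obtain ⟨v, hv⟩ := exists_ne (0 : E)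
  have hne : (f '' grassmannian E 1).Nonempty :=
    ⟨_, Submodule.span ℝ {v}, finrank_span_singleton hv, rfl⟩
  rw [heq] at hne ⊢
  exact ⟨hne.csSup_mem (Set.finite_range _), fun x hx => le_csSup (Set.finite_range _).bddAbove hx⟩

end SpectralFiltration

end OuterAngularValues

end AngularValues

end

theorem theorem3p5 {d l : ℕ} (hd : 1 ≤ d) (A : ℕ → EuclideanSpace ℝ (Fin d) →L[ℝ] EuclideanSpace ℝ (Fin d))
    (hA : AngularValues.BoundedInvertible A) (σm σp : Fin l → ℝ)
    (P : Fin (l + 1) → ℕ → EuclideanSpace ℝ (Fin d) →L[ℝ] EuclideanSpace ℝ (Fin d))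
    (hP : AngularValues.IsSpectralData A σm σp P) :
    (∀ s : ℕ, 1 ≤ s → s ≤ d →
      (∀ V ∈ AngularValues.grassmannian (EuclideanSpace ℝ (Fin d)) s,
        AngularValues.traceSpace P 0 V ∈ AngularValues.traceSpaces P 0 s ∧
        AngularValues.limsupAvg A V
          = AngularValues.limsupAvg A (AngularValues.traceSpace P 0 V) ∧
        AngularValues.liminfAvg A V
          = AngularValues.liminfAvg A (AngularValues.traceSpace P 0 V)) ∧
      AngularValues.upperOuter A s
        = sSup (AngularValues.limsupAvg A '' AngularValues.traceSpaces P 0 s) ∧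
      AngularValues.lowerOuter A s
        = sSup (AngularValues.liminfAvg A '' AngularValues.traceSpaces P 0 s)) ∧
    ((∀ (i : Fin l) (m : ℕ), Module.finrank ℝ (AngularValues.fiber P m i) = 1) →
      IsGreatest
        (Set.range fun i : Fin l =>
          Filter.liminf (fun n : ℕ => 1 / (n : ℝ) * ∑ j ∈ Finset.Icc 1 n,
            AngularValues.ang (AngularValues.fiber P (j - 1) i) (AngularValues.fiber P j i))
            Filter.atTop)
        (AngularValues.lowerOuter A 1) ∧
      IsGreatest
        (Set.range fun i : Fin l =>
          Filter.limsup (fun n : ℕ => 1 / (n : ℝ) * ∑ j ∈ Finset.Icc 1 n,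
            AngularValues.ang (AngularValues.fiber P (j - 1) i) (AngularValues.fiber P j i))
            Filter.atTop)
        (AngularValues.upperOuter A 1)) := by
  have h := hP.spectralFiltration hA
  have havg {s : ℕ} (hs : 1 ≤ s) (V : Submodule ℝ (EuclideanSpace ℝ (Fin d)))
      (hV : V ∈ AngularValues.grassmannian (EuclideanSpace ℝ (Fin d)) s) :=
    h.limsupAvg_eq_and_liminfAvg_eq (AngularValues.ne_bot_of_mem_grassmannian hs hV)
  refine ⟨fun s hs _ => ⟨fun V hV => ⟨?_, havg hs V hV⟩, ?_, ?_⟩, fun hfib => ?_⟩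
  · have := h.traceSpace_mem_traceSpaces V
    rwa [show Module.finrank ℝ V = s from hV] at this
  · exact congrArg sSup (h.image_grassmannian_eq fun V hV => (havg hs V hV).1)
  · exact congrArg sSup (h.image_grassmannian_eq fun V hV => (havg hs V hV).2)
  · have : Nonempty (Fin d) := ⟨⟨0, hd⟩⟩
    have : Nontrivial (EuclideanSpace ℝ (Fin d)) :=
      Module.nontrivial_of_finrank_pos (R := ℝ) (by rw [finrank_euclideanSpace_fin]; exact hd)
    simp_rw [← h.angSum_fiber]
    exact ⟨h.isGreatest_range_fiber (fun i => hfib i 0) fun V hV => (havg le_rfl V hV).2,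
      h.isGreatest_range_fiber (fun i => hfib i 0) fun V hV => (havg le_rfl V hV).1⟩
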